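/- Let $d\ge 2$, $k\ge 0$ be integers and $\alpha,\beta,\eta,s,r>0$. Let $S=(-\tfrac12,\tfrac12]^d$ with the toroidal metric $\rho(x,y)=\inf_{z\in\mathbb Z^d}\|x-y-z\|$. Let $\mathcal P_s$ be a Poisson point process of intensity $s$ on $S$ whose points carry independent weights with law $P(W>w)=w^{-\beta}$, $w\ge 1$. For a countable set of weighted points, join each pair $x\ne y$, independently of everything else given the points and weights, with probability $1-\exp\bigl(-\eta W_xW_y(\rho(x,y)/r)^{-\alpha}\bigr)$, and write $G(\cdot)$ for the resulting random graph. Let $D_k$ be the number of vertices of degree $k$ in $G(\mathcal P_s)$ and $\nu=E[D_k]$. For $x\in S$ and $w\ge1$ let $G(\mathcal P_s\cup\{x\})$ be the graph obtained by adding to $\mathcal P_s$ the point $x$ with weight $W_x=w$ (not depending on the process), and let $\tilde p_s(x,w)$ be the probability that $x$ has degree $k$ in it; by translation invariance this does not depend on $x$ and is also written $\tilde p_s(w)$. Suppose that for almost every $x\in S$ there are, on some probability space (which may depend on $x$), a random variable distributed as $D_k$ (again denoted $D_k$), a weight $W_x$ independent of it with $P(W_x>w)=w^{-\beta}$ for $w\ge1$,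 and a random variable $V_x$ with values in $\{0,1,2,\dots\}$ such that, for almost every $w$, the conditional law of $1+V_x$ given $W_x=w$ is the law of the number of vertices of degree $k$ in $G(\mathcal P_s\cup\{x\})$, with $x$ of weight $w$, conditioned on $x$ having degree $k$ in $G(\mathcal P_s\cup\{x\})$. Then $$d_{TV}\bigl(D_k,\mathrm{Po}(\nu)\bigr)\le (1\wedge\nu^{-1})\,s\int_S E\Bigl[E\bigl[\,|D_k-V_x|\,\big|\,W_x\bigr]\;\tilde p_s(x,W_x)\Bigr]\,dx,$$ where $d_{TV}(D_k,\mathrm{Po}(\nu))=\sup_{A\subseteq\{0,1,2,\dots\}}|P(D_k\in A)-P(\mathrm{Po}(\nu)\in A)|$. (If the integrand is not measurable in $x$, the integral is the lower integral.) -/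

import Mathlib

open MeasureTheory ProbabilityTheory
open scoped ENNReal unitInterval

namespace WeightedRCM

/-- The unit cube `(-1/2, 1/2]^d`. -/
def cube (d : ℕ) : Set (EuclideanSpace ℝ (Fin d)) :=
  {x | ∀ i, x i ∈ Set.Ioc (-(1 / 2) : ℝ) (1 / 2)}

/-- The point of `ℝ^d` with the integer coordinates `z`. -/
noncomputable def latticePoint {d : ℕ} (z : Fin d → ℤ) : EuclideanSpace ℝ (Fin d) :=
  WithLp.toLp 2 fun i => (z i : ℝ)

/-- The toroidal metric `inf {‖x - y - z‖ : z ∈ ℤ^d}`. -/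
noncomputable def torusDist {d : ℕ} (x y : EuclideanSpace ℝ (Fin d)) : ℝ :=
  ⨅ z : Fin d → ℤ, ‖x - y - latticePoint z‖

theorem torusDist_comm {d : ℕ} (x y : EuclideanSpace ℝ (Fin d)) :
    torusDist x y = torusDist y x := by
  unfold torusDist
  refine Equiv.iInf_congr (Equiv.neg (Fin d → ℤ)) fun z => ?_
  rw [← norm_neg]
  congr 1
  ext i
  simp [latticePoint]
  ring

/-- A location together with its weight. -/
abbrev Mark (d : ℕ) : Type := EuclideanSpace ℝ (Fin d) × ℝ

/-- The connection probability `1 - exp (-η w w' / (dist / r)^α)` of the vertices `(x, w)` and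
`(y, w')`; at distance zero the exponential is read as `exp (-∞) = 0`. -/
noncomputable def connProb {d : ℕ} (α η r : ℝ) (a b : Mark d) : ℝ :=
  if torusDist a.1 b.1 = 0 then 1
  else 1 - Real.exp (-(η * a.2 * b.2 / (torusDist a.1 b.1 / r) ^ α))

theorem connProb_comm {d : ℕ} (α η r : ℝ) (a b : Mark d) :
    connProb α η r a b = connProb α η r b a := by
  unfold connProb
  rw [torusDist_comm b.1 a.1, mul_right_comm]

/-- The random connection graph on the first `n` terms of a sequence `M` of weighted points: the
vertices `i ≠ j` are joined when the variable attached to the pair `{i, j}` does not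
exceed the connection probability of `M i` and `M j`. With independent uniform variables on `[0, 1]`
the edges are, given the weighted points, independent with exactly these probabilities. -/
noncomputable def graph {d : ℕ} (α η r : ℝ) (n : ℕ) (M : ℕ → Mark d) (U : Sym2 ℕ → I) :
    SimpleGraph (Fin n) where
  Adj i j := i ≠ j ∧ (U s((i : ℕ), (j : ℕ)) : ℝ) ≤ connProb α η r (M i) (M j)
  symm := ⟨fun i j h => ⟨h.1.symm, by rw [Sym2.eq_swap, connProb_comm]; exact h.2⟩⟩
  loopless := ⟨fun _ h => h.1 rfl⟩

open Classical in
/-- The number of vertices of degree `k`. -/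
noncomputable def numDegree {n : ℕ} (k : ℕ) (G : SimpleGraph (Fin n)) : ℕ :=
  (Finset.univ.filter fun i => G.degree i = k).card

open Classical in
/-- The degree of the last vertex. -/
noncomputable def lastDegree {n : ℕ} (G : SimpleGraph (Fin (n + 1))) : ℕ :=
  G.degree (Fin.last n)

/-- The outcomes: the number of points, the sequence of weighted points, and the variables
attached to the pairs of points. -/
abbrev Outcome (d : ℕ) : Type := ℕ × (ℕ → Mark d) × (Sym2 ℕ → I)

/-- The law of the Poisson process of intensity `s` on the unit cube (a Poisson number of mean `s`
of independent uniform points), with independent weights satisfying `P(W > w) = w^(-β)` for `w ≥ 1`,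
and with independent uniform variables on `[0, 1]` for the edges. -/
noncomputable def outcomeLaw (d : ℕ) (β s : ℝ) : Measure (Outcome d) :=
  (poissonMeasure s.toNNReal).prod
    ((Measure.infinitePi fun _ : ℕ => (volume.restrict (cube d)).prod (paretoMeasure 1 β)).prod
      (Measure.infinitePi fun _ : Sym2 ℕ => (volume : Measure I)))

/-- `G(P_s, r)`: the graph on the Poisson points. -/
noncomputable def poissonGraph {d : ℕ} (α η r : ℝ) (c : Outcome d) : SimpleGraph (Fin c.1) :=
  graph α η r c.1 c.2.1 c.2.2

/-- `G(P_s ∪ {x}, r)` with the weight `w` at `x`: the point `(x, w)` becomes the last vertex. -/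
noncomputable def augmentedGraph {d : ℕ} (α η r : ℝ) (a : Mark d) (c : Outcome d) :
    SimpleGraph (Fin (c.1 + 1)) :=
  graph α η r (c.1 + 1) (Function.update c.2.1 c.1 a) c.2.2

/-- The law of `D_k`, the number of vertices of degree `k` in `G(P_s, r)`. -/
noncomputable def degreeCountLaw (d : ℕ) (α β η s r : ℝ) (k : ℕ) : Measure ℕ :=
  (outcomeLaw d β s).map fun c => numDegree k (poissonGraph α η r c)

/-- `ν = E[D_k]`. -/
noncomputable def meanDegreeCount (d : ℕ) (α β η s r : ℝ) (k : ℕ) : ℝ≥0∞ :=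
  ∫⁻ c, (numDegree k (poissonGraph α η r c) : ℝ≥0∞) ∂(outcomeLaw d β s)

/-- The event `{f(x, P_s) = 1}` that `x`, with the weight `w`, has degree `k` in `G(P_s ∪ {x}, r)`. -/
def hasDegreeEvent {d : ℕ} (α η r : ℝ) (k : ℕ) (x : EuclideanSpace ℝ (Fin d)) (w : ℝ) :
    Set (Outcome d) :=
  {c | lastDegree (augmentedGraph α η r (x, w) c) = k}

/-- `p̃_s(x, w) = E[f(x, P_s) | W_x = w]`, the probability that `x` has degree `k` in `G(P_s ∪ {x}, r)`
when its weight is `w`. -/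
noncomputable def degreeProb {d : ℕ} (α β η s r : ℝ) (k : ℕ) (x : EuclideanSpace ℝ (Fin d))
    (w : ℝ) : ℝ≥0∞ :=
  outcomeLaw d β s (hasDegreeEvent α η r k x w)

/-- The law of the number of vertices of degree `k` in `G(P_s ∪ {x}, r)`, given that `x` has
weight `w` and degree `k`. -/
noncomputable def conditionedCountLaw {d : ℕ} (α β η s r : ℝ) (k : ℕ)
    (x : EuclideanSpace ℝ (Fin d)) (w : ℝ) : Measure ℕ :=
  (cond (outcomeLaw d β s) (hasDegreeEvent α η r k x w)).map
    fun c => numDegree k (augmentedGraph α η r (x, w) c)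

/-- A coupling at the point `x`: the variables `D`, `W`, `V` live on one probability space, `D` is a
copy of `D_k`, `W` is the weight at `x`, which is independent of `D`, and, conditionally on `W`, the
variable `1 + V` has the law of the number of vertices of degree `k` in `G(P_s ∪ {x}, r)` given that
`x` has degree `k`. -/
structure IsCouplingAt {d : ℕ} (α β η s r : ℝ) (k : ℕ) (x : EuclideanSpace ℝ (Fin d))
    {Ω : Type*} [MeasurableSpace Ω] (P : Measure Ω) [IsProbabilityMeasure P]
    (D : Ω → ℕ) (W : Ω → ℝ) (V : Ω → ℕ) : Prop where
  measurable_count : Measurable D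
  measurable_weight : Measurable W
  measurable_coupled : Measurable V
  law_count : P.map D = degreeCountLaw d α β η s r k
  law_weight : P.map W = paretoMeasure 1 β
  indep : IndepFun D W P
  cond_law : ∀ᵐ w ∂(paretoMeasure 1 β),
    condDistrib (fun ω => 1 + V ω) W P w = conditionedCountLaw α β η s r k x w

/-- The total variation distance `sup_A |μ(A) - ν(A)|` of two probability measures on `ℕ`. -/
noncomputable def tvDist (μ ν : Measure ℕ) : ℝ≥0∞ :=
  ⨆ A : Set ℕ, ENNReal.ofReal |μ.real A - ν.real A|

end WeightedRCM

namespace WeightedRCM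

/-! ### Stein's equation for the Poisson law -/

section Stein

/-! This is the Chen–Stein method with a size-bias coupling supplied by the Mecke formula. For a set
A and the mean l = ν > 0, Stein's equation l f(n+1) - n f(n) = 1_A(n) - Po(l)(A) has a solution with
increments at most 1 ∧ l⁻¹ (`abs_steinSolution_succ_sub_le`). Put g(n) = f(n+1) + c, where c makes g
nonnegative. Integrating the equation over the law of D = D_k expresses P(D ∈ A) - Po(l)(A) as l
E[g(D)] - E[D g(D-1)]; the constant c drops out because E[D] = l.

By the Mecke formula (`lintegral_mul_degreeCountLaw`), E[D g(D-1)] is s times the integral over x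
and w of g(D'-1) on the event that the added vertex has degree k, D' being the count in the
augmented graph. The coupling turns this into s ∫ E[p̃(W) g(V)] dx
(`IsCouplingAt.lintegral_degreeProb_mul_coupled`). The same formula with g = 1 computes l, and
independence of D and W gives l E[g(D)] = s ∫ E[p̃(W) g(D)] dx
(`IsCouplingAt.lintegral_degreeProb_mul_count`). The Lipschitz bound for g compares the two
integrands, and the tower property introduces the conditional expectation given W.

Everything is integrated in `ℝ≥0∞`, so no integrability in x has to be known; this is why a
nonnegative translate of f is used. -/

/-- The Poisson probability of `n`. -/
noncomputable def poissonWeight (l : ℝ) (n : ℕ) : ℝ :=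
  Real.exp (-l) * l ^ n / (n.factorial : ℝ)

theorem poissonWeight_pos {l : ℝ} (hl : 0 < l) (n : ℕ) : 0 < poissonWeight l n := by
  unfold poissonWeight
  positivity

theorem poissonWeight_zero (l : ℝ) : poissonWeight l 0 = Real.exp (-l) := by
  simp [poissonWeight]

theorem succ_mul_poissonWeight_succ (l : ℝ) (n : ℕ) :
    ((n : ℝ) + 1) * poissonWeight l (n + 1) = l * poissonWeight l n := by
  unfold poissonWeight
  rw [Nat.factorial_succ]
  push_cast
  field_simp
  ring

theorem hasSum_poissonWeight {l : ℝ} (hl : 0 < l) : HasSum (poissonWeight l) 1 :=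
  hasSum_one_poissonMeasure ⟨l, hl.le⟩

theorem poissonMeasure_real_eq_tsum {l : NNReal} (A : Set ℕ) :
    (poissonMeasure l).real A = ∑' n, A.indicator (poissonWeight l) n := by
  rw [← integral_indicator_one (MeasurableSet.of_discrete : MeasurableSet A),
    integral_poissonMeasure]
  refine tsum_congr fun n => ?_
  by_cases hn : n ∈ A <;> simp [hn, poissonWeight]

theorem hasSum_indicator_poissonWeight {l : NNReal} (hl : 0 < l) (A : Set ℕ) :
    HasSum (A.indicator (poissonWeight l)) ((poissonMeasure l).real A) := by
  rw [poissonMeasure_real_eq_tsum]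
  exact ((hasSum_poissonWeight (l := l) hl).summable.indicator A).hasSum

/-- The Poisson probability of `{0, …, n}`. -/
noncomputable def poissonHead (l : ℝ) (n : ℕ) : ℝ :=
  ∑ j ∈ Finset.range (n + 1), poissonWeight l j

/-- The Poisson probability of `A ∩ {0, …, n}`. -/
noncomputable def poissonHeadOn (l : ℝ) (A : Set ℕ) (n : ℕ) : ℝ :=
  ∑ j ∈ Finset.range (n + 1), A.indicator (poissonWeight l) j

theorem poissonHead_succ (l : ℝ) (n : ℕ) :
    poissonHead l (n + 1) = poissonHead l n + poissonWeight l (n + 1) :=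
  Finset.sum_range_succ _ _

theorem poissonHeadOn_succ (l : ℝ) (A : Set ℕ) (n : ℕ) :
    poissonHeadOn l A (n + 1) =
      poissonHeadOn l A n + A.indicator (poissonWeight l) (n + 1) :=
  Finset.sum_range_succ _ _

theorem poissonHead_nonneg {l : ℝ} (hl : 0 < l) (n : ℕ) : 0 ≤ poissonHead l n :=
  Finset.sum_nonneg fun _ _ => (poissonWeight_pos hl _).le

theorem indicator_poissonWeight_nonneg {l : ℝ} (hl : 0 < l) (A : Set ℕ) (n : ℕ) :
    0 ≤ A.indicator (poissonWeight l) n :=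
  Set.indicator_nonneg (fun _ _ => (poissonWeight_pos hl _).le) _

theorem indicator_poissonWeight_le {l : ℝ} (hl : 0 < l) (A : Set ℕ) (n : ℕ) :
    A.indicator (poissonWeight l) n ≤ poissonWeight l n :=
  Set.indicator_le_self' (fun _ _ => (poissonWeight_pos hl _).le) n

theorem poissonHeadOn_nonneg {l : ℝ} (hl : 0 < l) (A : Set ℕ) (n : ℕ) :
    0 ≤ poissonHeadOn l A n :=
  Finset.sum_nonneg fun _ _ => indicator_poissonWeight_nonneg hl A _

theorem hasSum_poissonTail {l : ℝ} (hl : 0 < l) (n : ℕ) :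
    HasSum (fun j => poissonWeight l (j + (n + 1))) (1 - poissonHead l n) :=
  (hasSum_nat_add_iff' (n + 1)).2 (hasSum_poissonWeight hl)

theorem hasSum_poissonTailOn {l : NNReal} (hl : 0 < l) (A : Set ℕ) (n : ℕ) :
    HasSum (fun j => A.indicator (poissonWeight l) (j + (n + 1)))
      ((poissonMeasure l).real A - poissonHeadOn l A n) :=
  (hasSum_nat_add_iff' (n + 1)).2 (hasSum_indicator_poissonWeight hl A)

theorem poissonHeadOn_le_real {l : NNReal} (hl : 0 < l) (A : Set ℕ) (n : ℕ) :
    poissonHeadOn l A n ≤ (poissonMeasure l).real A :=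
  sub_nonneg.1 <| (hasSum_poissonTailOn hl A n).nonneg fun _ =>
    indicator_poissonWeight_nonneg (l := l) hl A _

theorem real_sub_poissonHeadOn_le {l : NNReal} (hl : 0 < l) (A : Set ℕ) (n : ℕ) :
    (poissonMeasure l).real A - poissonHeadOn l A n ≤ 1 - poissonHead l n :=
  hasSum_le (fun _ => indicator_poissonWeight_le (l := l) hl A _)
    (hasSum_poissonTailOn hl A n) (hasSum_poissonTail (l := l) hl n)

theorem poissonHead_le_one {l : ℝ} (hl : 0 < l) (n : ℕ) : poissonHead l n ≤ 1 :=
  sub_nonneg.1 <| (hasSum_poissonTail hl n).nonneg fun _ => (poissonWeight_pos hl _).le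

/-- Termwise l p_j = (j+1) p_{j+1}, and j + 1 ≤ n + 1 in this range. -/
theorem mul_poissonHead_le {l : ℝ} (hl : 0 < l) (n : ℕ) :
    l * poissonHead l n ≤ (n + 1) * (poissonHead l (n + 1) - poissonWeight l 0) := by
  rw [poissonHead, poissonHead, Finset.sum_range_succ' _ (n + 1), add_sub_cancel_right,
    Finset.mul_sum, Finset.mul_sum]
  refine Finset.sum_le_sum fun j hj => ?_
  rw [← succ_mul_poissonWeight_succ]
  have : j ≤ n := Nat.lt_succ_iff.1 (Finset.mem_range.1 hj)
  have := poissonWeight_pos hl (j + 1)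
  gcongr

/-- The same recursion on the tail, where the factor j + 1 exceeds n + 1. -/
theorem mul_poissonTail_le {l : ℝ} (hl : 0 < l) (n : ℕ) :
    (n + 1) * (1 - poissonHead l (n + 1)) ≤ l * (1 - poissonHead l n) := by
  refine hasSum_le (fun j => ?_) ((hasSum_poissonTail hl (n + 1)).mul_left _)
    ((hasSum_poissonTail hl n).mul_left _)
  rw [← succ_mul_poissonWeight_succ]
  have := poissonWeight_pos hl (j + (n + 1) + 1)
  have h : j + (n + 1 + 1) = j + (n + 1) + 1 := by ring
  rw [h]
  gcongr
  linarith [(Nat.cast_nonneg j : (0 : ℝ) ≤ j)]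

theorem poissonTail_mul_zero_le {l : ℝ} (hl : 0 < l) (n : ℕ) :
    (1 - poissonHead l n) * poissonWeight l 0 ≤ poissonWeight l n := by
  have h0 := poissonWeight_pos hl 0
  induction n with
  | zero =>
    have := poissonHead_nonneg hl 0
    nlinarith
  | succ n ih =>
    have h1 := mul_poissonTail_le hl n
    have h2 := succ_mul_poissonWeight_succ l n
    have h3 : (0 : ℝ) < n + 1 := by positivity
    refine le_of_mul_le_mul_left ?_ h3
    rw [h2]
    calc _ = (n + 1) * (1 - poissonHead l (n + 1)) * poissonWeight l 0 := by ring
      _ ≤ l * (1 - poissonHead l n) * poissonWeight l 0 := by gcongr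
      _ = l * ((1 - poissonHead l n) * poissonWeight l 0) := by ring
      _ ≤ _ := by gcongr

/-- The solution at `n + 1` of the Stein equation of the Poisson law for the indicator of `A`. -/
noncomputable def steinSolution (l : NNReal) (A : Set ℕ) (n : ℕ) : ℝ :=
  (poissonHeadOn l A n - (poissonMeasure l).real A * poissonHead l n) / (l * poissonWeight l n)

theorem mul_steinSolution_zero {l : NNReal} (hl : 0 < l) (A : Set ℕ) :
    l * steinSolution l A 0 = A.indicator 1 0 - (poissonMeasure l).real A := by
  have h0 := (poissonWeight_pos (l := l) hl 0).ne'
  have h1 : (l : ℝ) ≠ 0 := (NNReal.coe_pos.2 hl).ne'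
  unfold steinSolution poissonHeadOn poissonHead
  by_cases h : 0 ∈ A <;> simp [h] <;> field_simp

theorem mul_steinSolution_succ {l : NNReal} (hl : 0 < l) (A : Set ℕ) (n : ℕ) :
    l * steinSolution l A (n + 1) - (n + 1) * steinSolution l A n =
      A.indicator 1 (n + 1) - (poissonMeasure l).real A := by
  have h0 := (poissonWeight_pos (l := l) hl (n + 1)).ne'
  have h1 : (l : ℝ) ≠ 0 := (NNReal.coe_pos.2 hl).ne'
  have h2 : ((n : ℝ) + 1) ≠ 0 := by positivity
  unfold steinSolution
  rw [← succ_mul_poissonWeight_succ (l : ℝ) n, poissonHeadOn_succ, poissonHead_succ]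
  by_cases h : n + 1 ∈ A <;> simp [h] <;> field_simp <;> ring

/-- The increment is additive in A, so the mass of A can be split into the parts below, at and above
n + 1. Only the atom n + 1 can contribute positively, and its contribution is at most (1 - e^{-l}) /
l. -/
theorem steinSolution_succ_sub_le {l : NNReal} (hl : 0 < l) (A : Set ℕ) (n : ℕ) :
    steinSolution l A (n + 1) - steinSolution l A n ≤ (1 - Real.exp (-l)) / l := by
  have hl' : (0 : ℝ) < l := hl
  have hp := poissonWeight_pos (l := l) hl (n + 1)
  have hn : (0 : ℝ) < n + 1 := by positivity
  unfold steinSolution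
  rw [← succ_mul_poissonWeight_succ (l : ℝ) n, ← poissonWeight_zero]
  rw [show (poissonHeadOn l A (n + 1) - (poissonMeasure l).real A * poissonHead l (n + 1)) /
      (l * poissonWeight l (n + 1)) - (poissonHeadOn l A n - (poissonMeasure l).real A *
      poissonHead l n) / ((n + 1) * poissonWeight l (n + 1)) =
      ((n + 1) * (poissonHeadOn l A (n + 1) - (poissonMeasure l).real A * poissonHead l (n + 1)) -
      l * (poissonHeadOn l A n - (poissonMeasure l).real A * poissonHead l n)) /
      ((n + 1) * poissonWeight l (n + 1)) / l by field_simp]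
  gcongr
  rw [div_le_iff₀ (by positivity)]
  have ha := poissonHeadOn_nonneg (l := l) hl A n
  have he := indicator_poissonWeight_nonneg (l := l) hl A (n + 1)
  have he' := indicator_poissonWeight_le (l := l) hl A (n + 1)
  have hb := poissonHeadOn_le_real hl A (n + 1)
  have h1 := mul_poissonHead_le (l := l) hl n
  have h2 := mul_poissonTail_le (l := l) hl n
  have hw := poissonWeight_pos (l := l) hl 0
  have hw1 : poissonWeight l 0 ≤ 1 := by rw [poissonWeight_zero]; simp
  rw [poissonHeadOn_succ] at hb ⊢
  set a := poissonHeadOn l A n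
  set e := A.indicator (poissonWeight l) (n + 1)
  set q := (poissonMeasure l).real A
  set u := poissonHead l n
  set v := poissonHead l (n + 1)
  set w := poissonWeight l 0
  set p := poissonWeight l (n + 1)
  -- Writing q = a + e + (q - (a + e)), the numerator is the sum of the left sides of `k1`, `k2` and
  -- `k3`.
  have k1 : a * ((n + 1) * (1 - v) - l * (1 - u)) ≤ 0 :=
    mul_nonpos_of_nonneg_of_nonpos ha (by linarith)
  have k2 : e * ((n + 1) * (1 - v) + l * u) ≤ e * ((n + 1) * (1 - w)) :=
    mul_le_mul_of_nonneg_left (by linarith) he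
  have k3 : (q - (a + e)) * (l * u - (n + 1) * v) ≤ 0 :=
    mul_nonpos_of_nonneg_of_nonpos (by linarith) (by nlinarith)
  have k4 : e * ((n + 1) * (1 - w)) ≤ p * ((n + 1) * (1 - w)) :=
    mul_le_mul_of_nonneg_right he' (mul_nonneg hn.le (by linarith))
  linarith

theorem steinSolution_compl (l : NNReal) (A : Set ℕ) (n : ℕ) :
    steinSolution l Aᶜ n = -steinSolution l A n := by
  have h : poissonHeadOn l Aᶜ n = poissonHead l n - poissonHeadOn l A n := by
    unfold poissonHeadOn poissonHead
    rw [← Finset.sum_sub_distrib]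
    refine Finset.sum_congr rfl fun j _ => ?_
    by_cases h : j ∈ A <;> simp [h]
  unfold steinSolution
  rw [h, probReal_compl_eq_one_sub (MeasurableSet.of_discrete : MeasurableSet A)]
  ring

theorem one_sub_exp_neg_div_le {l : ℝ} (hl : 0 < l) :
    (1 - Real.exp (-l)) / l ≤ min 1 l⁻¹ := by
  refine le_min ?_ ?_
  · rw [div_le_one hl]
    linarith [Real.add_one_le_exp (-l)]
  · rw [div_eq_mul_inv]
    have := Real.exp_pos (-l)
    exact mul_le_of_le_one_left (inv_nonneg.2 hl.le) (by linarith)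

/-- Passing to the complement of A changes the sign of the solution, so the upper bound on
increments also gives the lower one. -/
theorem abs_steinSolution_succ_sub_le {l : NNReal} (hl : 0 < l) (A : Set ℕ) (n : ℕ) :
    |steinSolution l A (n + 1) - steinSolution l A n| ≤ min 1 (l : ℝ)⁻¹ := by
  refine le_trans ?_ (one_sub_exp_neg_div_le (l := l) hl)
  rw [abs_le]
  have h := steinSolution_succ_sub_le hl Aᶜ n
  rw [steinSolution_compl, steinSolution_compl] at h
  exact ⟨by linarith, steinSolution_succ_sub_le hl A n⟩

theorem abs_sub_le_mul_of_abs_succ_sub_le {f : ℕ → ℝ} {c : ℝ}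
    (hf : ∀ n, |f (n + 1) - f n| ≤ c) (m n : ℕ) : |f m - f n| ≤ c * |(m : ℝ) - n| := by
  have key : ∀ a b : ℕ, |f (a + b) - f a| ≤ c * b := by
    intro a b
    induction b with
    | zero => simp
    | succ b ih =>
      calc |f (a + (b + 1)) - f a| ≤ |f (a + b + 1) - f (a + b)| + |f (a + b) - f a| :=
            abs_sub_le _ _ _
        _ ≤ c + c * b := add_le_add (hf _) ih
        _ = _ := by push_cast; ring
  rcases le_total n m with h | h
  · obtain ⟨b, rfl⟩ := Nat.exists_eq_add_of_le h
    simpa using key n b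
  · obtain ⟨b, rfl⟩ := Nat.exists_eq_add_of_le h
    rw [abs_sub_comm]
    simpa using key m b

/-- The value of the bound is immaterial; uniformity in n is what permits a nonnegative translate.
The numerator is at least minus the Poisson tail beyond n, which `poissonTail_mul_zero_le` compares
with p_n. -/
theorem neg_le_steinSolution {l : NNReal} (hl : 0 < l) (A : Set ℕ) (n : ℕ) :
    -(l * poissonWeight l 0)⁻¹ ≤ steinSolution l A n := by
  have hl' : (0 : ℝ) < l := hl
  have hp := poissonWeight_pos (l := l) hl n
  have hw := poissonWeight_pos (l := l) hl 0
  unfold steinSolution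
  rw [le_div_iff₀ (by positivity), mul_inv, neg_mul, neg_le]
  have ha := poissonHeadOn_nonneg (l := l) hl A n
  have hb := poissonHeadOn_le_real hl A n
  have hb' := real_sub_poissonHeadOn_le hl A n
  have hP := poissonHead_nonneg (l := l) hl n
  have hP' := poissonHead_le_one (l := l) hl n
  have h1 := poissonTail_mul_zero_le (l := l) hl n
  have h2 : -(poissonHeadOn l A n - (poissonMeasure l).real A * poissonHead l n) ≤
      1 - poissonHead l n := by
    nlinarith
  refine h2.trans ?_
  rw [show (l : ℝ)⁻¹ * (poissonWeight l 0)⁻¹ * (l * poissonWeight l n) =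
    poissonWeight l n / poissonWeight l 0 by field_simp, le_div_iff₀ hw]
  exact h1

/-- A nonnegative translate of the solution of the Stein equation of the Poisson law, with its
Lipschitz bound. -/
theorem exists_stein_nnreal {l : NNReal} (hl : 0 < l) (A : Set ℕ) :
    ∃ (g : ℕ → NNReal) (c : NNReal),
      (∀ n : ℕ, A.indicator (1 : ℕ → ℝ≥0∞) n + n * g (n - 1) + c * l =
        poissonMeasure l A + l * g n + c * n) ∧
      ∀ m n : ℕ, (g m : ℝ≥0∞) ≤
        g n + min 1 (l : ℝ≥0∞)⁻¹ * ENNReal.ofReal |(m : ℝ) - n| := by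
  have hl' : (0 : ℝ) < l := hl
  have hw := poissonWeight_pos (l := l) hl 0
  have hc : 0 ≤ ((l : ℝ) * poissonWeight l 0)⁻¹ := by positivity
  have hg : ∀ n, 0 ≤ steinSolution l A n + ((l : ℝ) * poissonWeight l 0)⁻¹ := fun n => by
    linarith [neg_le_steinSolution hl A n]
  obtain ⟨c, hc'⟩ : ∃ c : NNReal, (c : ℝ) = ((l : ℝ) * poissonWeight l 0)⁻¹ := ⟨⟨_, hc⟩, rfl⟩
  have hg' : ∀ n, ∃ y : NNReal, (y : ℝ) = steinSolution l A n + c := fun n =>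
    ⟨⟨_, hg n⟩, by rw [hc']; rfl⟩
  choose g hg' using hg'
  refine ⟨g, c, fun n => ?_, fun m n => ?_⟩
  · have hA : A.indicator (1 : ℕ → ℝ≥0∞) n = ((A.indicator (1 : ℕ → NNReal) n : NNReal) : ℝ≥0∞) := by
      by_cases h : n ∈ A <;> simp [h]
    have hi : A.indicator (fun x => ((1 : ℕ → NNReal) x : ℝ)) n = A.indicator (1 : ℕ → ℝ) n := by
      by_cases h : n ∈ A <;> simp [h]
    have hq : poissonMeasure l A = ((((poissonMeasure l) A).toNNReal : NNReal) : ℝ≥0∞) :=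
      (ENNReal.coe_toNNReal (measure_ne_top _ _)).symm
    rw [hA, hq]
    norm_cast
    rw [← NNReal.coe_inj]
    push_cast
    rw [hi, ← measureReal_def]
    simp only [hg']
    -- At n = 0 the factor n kills the term containing the truncated n - 1.
    rcases n with _ | n
    · have := mul_steinSolution_zero hl A
      push_cast
      linarith
    · have := mul_steinSolution_succ hl A n
      simp only [Nat.add_sub_cancel]
      push_cast
      linarith
  · have h := abs_sub_le_mul_of_abs_succ_sub_le (abs_steinSolution_succ_sub_le hl A) m n
    have h' := (abs_le.1 h).2
    have hm : min 1 (l : ℝ≥0∞)⁻¹ = ENNReal.ofReal (min 1 (l : ℝ)⁻¹) := by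
      rw [ENNReal.ofReal_min, ENNReal.ofReal_one, ENNReal.ofReal_inv_of_pos hl',
        ENNReal.ofReal_coe_nnreal]
    rw [hm, ← ENNReal.ofReal_mul (by positivity), ← ENNReal.ofReal_coe_nnreal (p := g m),
      ← ENNReal.ofReal_coe_nnreal (p := g n), ← ENNReal.ofReal_add (by positivity) (by positivity)]
    refine ENNReal.ofReal_le_ofReal ?_
    rw [hg', hg']
    linarith

end Stein

/-! ### Measurability of graph functionals -/

section Measurability

theorem isProbabilityMeasure_restrict_cube (d : ℕ) :
    IsProbabilityMeasure (volume.restrict (cube d)) := by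
  refine ⟨?_⟩
  have h : cube d = WithLp.ofLp ⁻¹'
      (Set.univ.pi fun _ : Fin d => Set.Ioc (-(1 / 2) : ℝ) (1 / 2)) := by
    ext x
    simp [cube]
  rw [Measure.restrict_apply_univ, h,
    (PiLp.volume_preserving_ofLp (Fin d)).measure_preimage
      (MeasurableSet.univ_pi fun _ => measurableSet_Ioc).nullMeasurableSet,
    volume_pi_pi]
  simp [Real.volume_Ioc]
  norm_num

theorem measurable_torusDist {d : ℕ} :
    Measurable fun p : EuclideanSpace ℝ (Fin d) × EuclideanSpace ℝ (Fin d) =>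
      torusDist p.1 p.2 := by
  have h : ∀ z : Fin d → ℤ,
      Measurable fun p : EuclideanSpace ℝ (Fin d) × EuclideanSpace ℝ (Fin d) =>
        ‖p.1 - p.2 - latticePoint z‖ := fun z =>
    ((measurable_fst.sub measurable_snd).sub_const _).norm
  exact Measurable.iInf h

attribute [local irreducible] torusDist connProb

theorem measurable_torusDist_comp {d : ℕ} {Ω : Type*} [MeasurableSpace Ω]
    {f g : Ω → EuclideanSpace ℝ (Fin d)} (hf : Measurable f) (hg : Measurable g) :
    Measurable fun ω => torusDist (f ω) (g ω) :=
  measurable_torusDist.comp (hf.prodMk hg)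

theorem measurable_connProb_comp {d : ℕ} (α η r : ℝ) {Ω : Type*} [MeasurableSpace Ω]
    {f g : Ω → Mark d} (hf : Measurable f) (hg : Measurable g) :
    Measurable fun ω => connProb α η r (f ω) (g ω) := by
  have h : Measurable fun ω => torusDist (f ω).1 (g ω).1 :=
    measurable_torusDist_comp hf.fst hg.fst
  have h' := (h.div_const r).pow_const α
  have hw : Measurable fun ω =>
      1 - Real.exp (-(η * (f ω).2 * (g ω).2 / (torusDist (f ω).1 (g ω).1 / r) ^ α)) := by
    have := hf.snd
    have := hg.snd
    fun_prop
  unfold connProb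
  exact Measurable.ite (measurableSet_eq_fun h measurable_const) measurable_const hw

/-- There are finitely many graphs on `Fin n`, each cut out by finitely many adjacency events, so
any function of the graph is measurable. -/
theorem measurable_graph_comp {d n : ℕ} {β : Type*} [MeasurableSpace β] (α η r : ℝ)
    (φ : SimpleGraph (Fin n) → β) :
    Measurable fun p : (ℕ → Mark d) × (Sym2 ℕ → I) => φ (graph α η r n p.1 p.2) := by
  have hadj : ∀ i j : Fin n, MeasurableSet
      {p : (ℕ → Mark d) × (Sym2 ℕ → I) | (graph α η r n p.1 p.2).Adj i j} := by
    intro i j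
    have hU : Measurable fun p : (ℕ → Mark d) × (Sym2 ℕ → I) =>
        (p.2 s((i : ℕ), (j : ℕ)) : ℝ) := by fun_prop
    have hM : Measurable fun p : (ℕ → Mark d) × (Sym2 ℕ → I) => connProb α η r (p.1 i) (p.1 j) :=
      measurable_connProb_comp α η r ((measurable_pi_apply _).comp measurable_fst)
        ((measurable_pi_apply _).comp measurable_fst)
    have h : {p : (ℕ → Mark d) × (Sym2 ℕ → I) | (graph α η r n p.1 p.2).Adj i j} =
        {_p | i ≠ j} ∩
          {p | (p.2 s((i : ℕ), (j : ℕ)) : ℝ) ≤ connProb α η r (p.1 i) (p.1 j)} := by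
      ext p
      exact Iff.rfl
    rw [h]
    exact (MeasurableSet.const _).inter (measurableSet_le hU hM)
  intro s _
  have h : (fun p : (ℕ → Mark d) × (Sym2 ℕ → I) => φ (graph α η r n p.1 p.2)) ⁻¹' s =
      ⋃ G ∈ φ ⁻¹' s, ⋂ i, ⋂ j, {p | (graph α η r n p.1 p.2).Adj i j ↔ G.Adj i j} := by
    ext p
    simp only [Set.mem_preimage, Set.mem_iUnion, Set.mem_iInter, Set.mem_ofPred_eq, exists_prop]
    constructor
    · exact fun hp => ⟨_, hp, fun _ _ => Iff.rfl⟩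
    · rintro ⟨G, hG, h⟩
      rwa [SimpleGraph.ext (funext₂ fun i j => propext (h i j))]
  rw [h]
  refine MeasurableSet.biUnion (Set.to_countable _) fun G _ =>
    MeasurableSet.iInter fun i => MeasurableSet.iInter fun j => ?_
  exact (hadj i j).iff (MeasurableSet.const _)

theorem measurable_poissonGraph_comp {d : ℕ} {β : Type*} [MeasurableSpace β] (α η r : ℝ)
    (φ : ∀ n, SimpleGraph (Fin n) → β) :
    Measurable fun c : Outcome d => φ c.1 (poissonGraph α η r c) :=
  measurable_from_prod_countable_right fun n => measurable_graph_comp α η r (φ n)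

theorem measurable_update_pair {X : Type*} [MeasurableSpace X] (n : ℕ) :
    Measurable fun p : X × (ℕ → X) => Function.update p.2 n p.1 := by
  refine measurable_pi_iff.2 fun i => ?_
  by_cases h : i = n
  · subst h
    simpa using measurable_fst
  · simp only [Function.update_of_ne h]
    fun_prop

theorem measurable_augmentedGraph_comp {d : ℕ} {β : Type*} [MeasurableSpace β] (α η r : ℝ)
    (φ : ∀ n, SimpleGraph (Fin (n + 1)) → β) :
    Measurable fun p : Mark d × Outcome d => φ p.2.1 (augmentedGraph α η r p.1 p.2) := by
  have h : Measurable fun q : ℕ × Mark d × (ℕ → Mark d) × (Sym2 ℕ → I) =>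
      φ q.1 (graph α η r (q.1 + 1) (Function.update q.2.2.1 q.1 q.2.1) q.2.2.2) := by
    refine measurable_from_prod_countable_right fun n => ?_
    refine (measurable_graph_comp α η r (φ n)).comp (Measurable.prodMk ?_ (by fun_prop))
    exact (measurable_update_pair n).comp (by fun_prop : Measurable
      fun q : Mark d × (ℕ → Mark d) × (Sym2 ℕ → I) => (q.1, q.2.1))
  exact h.comp (by fun_prop :
    Measurable fun p : Mark d × Outcome d => (p.2.1, p.1, p.2.2.1, p.2.2.2))

end Measurability

/-! ### Resampling and permuting the points -/

section Exchangeability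

theorem measurePreserving_update_infinitePi {X : Type*} [MeasurableSpace X] (μ : Measure X)
    [IsProbabilityMeasure μ] (n : ℕ) :
    MeasurePreserving (fun p : X × (ℕ → X) => Function.update p.2 n p.1)
      (μ.prod (Measure.infinitePi fun _ => μ)) (Measure.infinitePi fun _ => μ) := by
  refine ⟨measurable_update_pair n, Measure.eq_infinitePi _ fun s t ht => ?_⟩
  rw [Measure.map_apply (measurable_update_pair n)
    (MeasurableSet.pi s.countable_toSet fun i _ => ht i)]
  have h : (fun p : X × (ℕ → X) => Function.update p.2 n p.1) ⁻¹' (Set.pi s t) =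
      (if n ∈ s then t n else Set.univ) ×ˢ Set.pi (s.erase n : Finset ℕ) t := by
    ext p
    simp only [Set.mem_preimage, Set.mem_pi, Set.mem_prod, Finset.mem_coe, Finset.mem_erase]
    constructor
    · intro h
      refine ⟨?_, fun i hi => by simpa [hi.1] using h i hi.2⟩
      split_ifs with hn
      · simpa using h n hn
      · trivial
    · rintro ⟨h1, h2⟩ i hi
      by_cases hin : i = n
      · subst hin
        simpa [hi] using h1
      · simpa [hin] using h2 i ⟨hin, hi⟩
  rw [h, Measure.prod_prod, Measure.infinitePi_pi _ fun i _ => ht i]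
  by_cases hn : n ∈ s
  · rw [if_pos hn, Finset.mul_prod_erase s (fun i => μ (t i)) hn]
  · simp [hn]

theorem measurePreserving_reindex_infinitePi {ι X : Type*} [MeasurableSpace X] (μ : Measure X)
    [IsProbabilityMeasure μ] {f : ι → ι} (hf : Function.Injective f) :
    MeasurePreserving (fun x : ι → X => x ∘ f) (Measure.infinitePi fun _ => μ)
      (Measure.infinitePi fun _ => μ) :=
  ⟨measurable_pi_iff.2 fun i => measurable_pi_apply (f i),
    Measure.map_infinitePi_infinitePi_of_inj (P := fun _ => μ) hf⟩

open Classical in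
theorem degree_comap_equiv {n : ℕ} (G : SimpleGraph (Fin n)) (e : Fin n ≃ Fin n) (i : Fin n) :
    (G.comap e).degree i = G.degree (e i) :=
  ((SimpleGraph.Iso.comap e G).degree_eq i).symm

theorem numDegree_comap_equiv {n : ℕ} (k : ℕ) (G : SimpleGraph (Fin n)) (e : Fin n ≃ Fin n) :
    numDegree k (G.comap e) = numDegree k G := by
  unfold numDegree
  refine Finset.card_equiv e fun i => ?_
  simp only [Finset.mem_filter, Finset.mem_univ, true_and]
  have h := degree_comap_equiv G e i
  constructor <;> intro h'
  · rw [← h']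
    convert h.symm
  · rw [← h']
    convert h

/-- Edge variables must be permuted along with the points; both permutations preserve the product
laws, so the vertices are exchangeable. -/
theorem graph_swap {d m : ℕ} (α η r : ℝ) (M : ℕ → Mark d) (U : Sym2 ℕ → I) (i j : Fin m) :
    graph α η r m (M ∘ Equiv.swap (i : ℕ) j) (U ∘ Sym2.map (Equiv.swap (i : ℕ) j)) =
      (graph α η r m M U).comap (Equiv.swap i j) := by
  have h : ∀ a : Fin m, ((Equiv.swap i j a : Fin m) : ℕ) = Equiv.swap (i : ℕ) j a := by
    intro a
    simp only [Equiv.swap_apply_def, Fin.ext_iff]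
    split_ifs <;> rfl
  ext a b
  simp [graph, h]

end Exchangeability

/-! ### The Mecke formula -/

section Mecke

theorem lintegral_poissonMeasure (l : NNReal) (f : ℕ → ℝ≥0∞) :
    ∫⁻ n, f n ∂poissonMeasure l = ∑' n, ENNReal.ofReal (poissonWeight l n) * f n := by
  rw [poissonMeasure, lintegral_sum_measure]
  simp [lintegral_smul_measure, poissonWeight]

/-- The Mecke formula for the number of points alone, from (n+1) p_{n+1} = l p_n. -/
theorem lintegral_mul_pred_poissonMeasure (l : NNReal) (f : ℕ → ℝ≥0∞) :
    ∫⁻ n, n * f (n - 1) ∂poissonMeasure l = l * ∫⁻ n, f n ∂poissonMeasure l := by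
  rw [lintegral_poissonMeasure, lintegral_poissonMeasure, tsum_eq_zero_add' ENNReal.summable,
    ← ENNReal.tsum_mul_left]
  simp only [Nat.cast_zero, zero_mul, mul_zero, zero_add, Nat.add_sub_cancel]
  refine tsum_congr fun n => ?_
  have h : ENNReal.ofReal (poissonWeight l (n + 1)) * ((n + 1 : ℕ) : ℝ≥0∞) =
      l * ENNReal.ofReal (poissonWeight l n) := by
    rw [← ENNReal.ofReal_natCast, ← ENNReal.ofReal_coe_nnreal,
      ← ENNReal.ofReal_mul' (Nat.cast_nonneg _), ← ENNReal.ofReal_mul (NNReal.coe_nonneg l),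
      ← succ_mul_poissonWeight_succ, mul_comm]
    push_cast
    rfl
  rw [← mul_assoc, h, mul_assoc]

/-- The law of a weighted point: uniform location and independent Pareto weight. -/
noncomputable def markLaw (d : ℕ) (β : ℝ) : Measure (Mark d) :=
  (volume.restrict (cube d)).prod (paretoMeasure 1 β)

/-- The joint law of the sequence of weighted points and of the edge variables. -/
noncomputable def sequenceLaw (d : ℕ) (β : ℝ) : Measure ((ℕ → Mark d) × (Sym2 ℕ → I)) :=
  (Measure.infinitePi fun _ : ℕ => markLaw d β).prod
    (Measure.infinitePi fun _ : Sym2 ℕ => (volume : Measure I))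

theorem outcomeLaw_eq_prod (d : ℕ) (β s : ℝ) :
    outcomeLaw d β s = (poissonMeasure s.toNNReal).prod (sequenceLaw d β) :=
  rfl

theorem isProbabilityMeasure_markLaw (d : ℕ) {β : ℝ} (hβ : 0 < β) :
    IsProbabilityMeasure (markLaw d β) := by
  have := isProbabilityMeasure_restrict_cube d
  have := isProbabilityMeasure_paretoMeasure one_pos hβ
  unfold markLaw
  infer_instance

theorem isProbabilityMeasure_sequenceLaw (d : ℕ) {β : ℝ} (hβ : 0 < β) :
    IsProbabilityMeasure (sequenceLaw d β) := by
  have := isProbabilityMeasure_markLaw d hβ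
  unfold sequenceLaw
  infer_instance

theorem isProbabilityMeasure_outcomeLaw (d : ℕ) {β : ℝ} (hβ : 0 < β) (s : ℝ) :
    IsProbabilityMeasure (outcomeLaw d β s) := by
  have := isProbabilityMeasure_sequenceLaw d hβ
  rw [outcomeLaw_eq_prod]
  infer_instance

theorem isProbabilityMeasure_degreeCountLaw (d : ℕ) {β : ℝ} (hβ : 0 < β) (α η s r : ℝ) (k : ℕ) :
    IsProbabilityMeasure (degreeCountLaw d α β η s r k) := by
  have := isProbabilityMeasure_outcomeLaw d hβ s
  exact Measure.isProbabilityMeasure_map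
    (measurable_poissonGraph_comp α η r fun _ => numDegree k).aemeasurable

/-- The value `g D` on the event that the last vertex has degree `k`, where `D` is the number of
vertices of degree `k`. -/
noncomputable def lastTerm (k : ℕ) (g : ℕ → ℝ≥0∞) {n : ℕ} (G : SimpleGraph (Fin (n + 1))) :
    ℝ≥0∞ :=
  if lastDegree G = k then g (numDegree k G) else 0

open Classical in
theorem numDegree_mul_eq_sum {n : ℕ} (k : ℕ) (g : ℕ → ℝ≥0∞) (G : SimpleGraph (Fin (n + 1))) :
    numDegree k G * g (numDegree k G) =
      ∑ i, lastTerm k g (G.comap (Equiv.swap i (Fin.last n))) := by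
  have h : ∀ i, lastTerm k g (G.comap (Equiv.swap i (Fin.last n))) =
      if G.degree i = k then g (numDegree k G) else 0 := by
    intro i
    have hd : lastDegree (G.comap (Equiv.swap i (Fin.last n))) = G.degree i := by
      have h := degree_comap_equiv G (Equiv.swap i (Fin.last n)) (Fin.last n)
      rw [Equiv.swap_apply_right] at h
      rw [← h]
      unfold lastDegree
      congr
    rw [lastTerm, hd, numDegree_comap_equiv]
  simp_rw [h]
  rw [← Finset.sum_filter, Finset.sum_const, nsmul_eq_mul]
  rfl

theorem lintegral_lastTerm_swap {d : ℕ} {β : ℝ} (hβ : 0 < β) (α η r : ℝ) (k : ℕ)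
    (g : ℕ → ℝ≥0∞) {m : ℕ} (i j : Fin (m + 1)) :
    ∫⁻ p, lastTerm k g ((graph α η r (m + 1) p.1 p.2).comap (Equiv.swap i j)) ∂sequenceLaw d β =
      ∫⁻ p, lastTerm k g (graph α η r (m + 1) p.1 p.2) ∂sequenceLaw d β := by
  have := isProbabilityMeasure_markLaw d hβ
  have hσ : Function.Injective (Equiv.swap (i : ℕ) j) := (Equiv.swap (i : ℕ) j).injective
  have h := (measurePreserving_reindex_infinitePi (markLaw d β) hσ).prod
    (measurePreserving_reindex_infinitePi (volume : Measure I) (Sym2.map.injective hσ))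
  have h' := h.lintegral_comp (measurable_graph_comp α η r (lastTerm (n := m) k g))
  refine Eq.trans ?_ h'
  refine lintegral_congr fun p => ?_
  simp only [Prod.map]
  rw [graph_swap]

/-- The count is a sum of indicators over vertices, and by exchangeability each vertex contributes
as much as the last one. The form n - 1 + 1 fits `lintegral_mul_pred_poissonMeasure`. -/
theorem lintegral_numDegree_mul {d : ℕ} {β : ℝ} (hβ : 0 < β) (α η r : ℝ) (k : ℕ)
    (g : ℕ → ℝ≥0∞) (n : ℕ) :
    ∫⁻ p, numDegree k (graph α η r n p.1 p.2) * g (numDegree k (graph α η r n p.1 p.2))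
        ∂sequenceLaw d β =
      n * ∫⁻ p, lastTerm k g (graph α η r (n - 1 + 1) p.1 p.2) ∂sequenceLaw d β := by
  rcases n with _ | m
  · simp [numDegree]
  · simp_rw [numDegree_mul_eq_sum]
    rw [lintegral_finsetSum _ fun i _ => measurable_graph_comp α η r fun G : SimpleGraph _ =>
      lastTerm k g (G.comap (Equiv.swap i (Fin.last m)))]
    simp_rw [lintegral_lastTerm_swap hβ]
    simp

/-- The integral of `g D` over the event that the added vertex `a` has degree `k`, where `D` is
the number of vertices of degree `k` in the augmented graph. -/
noncomputable def palmIntegral {d : ℕ} (α β η s r : ℝ) (k : ℕ) (g : ℕ → ℝ≥0∞) (a : Mark d) :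
    ℝ≥0∞ :=
  ∫⁻ c, lastTerm k g (augmentedGraph α η r a c) ∂outcomeLaw d β s

theorem measurable_palmIntegral {d : ℕ} {β : ℝ} (hβ : 0 < β) (α η s r : ℝ) (k : ℕ)
    (g : ℕ → ℝ≥0∞) : Measurable (palmIntegral (d := d) α β η s r k g) := by
  have := isProbabilityMeasure_outcomeLaw d hβ s
  exact (measurable_augmentedGraph_comp α η r fun _ => lastTerm k g).lintegral_prod_right'

/-- Inserting an independent mark at index n reproduces the law of the sequence, so an added random
vertex is just one more term of it. -/
theorem lintegral_update_mark {d : ℕ} {β : ℝ} (hβ : 0 < β) (n : ℕ)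
    {f : (ℕ → Mark d) × (Sym2 ℕ → I) → ℝ≥0∞} (hf : Measurable f) :
    ∫⁻ a, ∫⁻ p, f (Function.update p.1 n a, p.2) ∂sequenceLaw d β ∂markLaw d β =
      ∫⁻ p, f p ∂sequenceLaw d β := by
  have := isProbabilityMeasure_markLaw d hβ
  have hF : Measurable fun M : ℕ → Mark d =>
      ∫⁻ U, f (M, U) ∂Measure.infinitePi fun _ : Sym2 ℕ => (volume : Measure I) :=
    hf.lintegral_prod_right'
  have h := (measurePreserving_update_infinitePi (markLaw d β) n).lintegral_comp hF
  unfold sequenceLaw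
  rw [lintegral_prod _ hf.aemeasurable, ← h]
  refine Eq.trans ?_
    (lintegral_prod _ (hF.comp (measurable_update_pair n)).aemeasurable).symm
  refine lintegral_congr fun a => ?_
  refine lintegral_prod _ (hf.comp (Measurable.prodMk ?_ measurable_snd)).aemeasurable
  exact (measurable_update_pair n).comp (measurable_const.prodMk measurable_fst)

theorem lintegral_palmIntegral {d : ℕ} {β : ℝ} (hβ : 0 < β) (α η s r : ℝ) (k : ℕ)
    (g : ℕ → ℝ≥0∞) :
    ∫⁻ a, palmIntegral α β η s r k g a ∂markLaw d β =
      ∫⁻ n, ∫⁻ p, lastTerm k g (graph α η r (n + 1) p.1 p.2) ∂sequenceLaw d β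
        ∂poissonMeasure s.toNNReal := by
  have := isProbabilityMeasure_markLaw d hβ
  have := isProbabilityMeasure_sequenceLaw d hβ
  have hm := measurable_augmentedGraph_comp (d := d) α η r fun _ => lastTerm k g
  have h1 : ∀ a : Mark d, palmIntegral α β η s r k g a =
      ∫⁻ n, ∫⁻ p, lastTerm k g (augmentedGraph α η r a (n, p)) ∂sequenceLaw d β
        ∂poissonMeasure s.toNNReal := fun a => by
    unfold palmIntegral
    rw [outcomeLaw_eq_prod, lintegral_prod]
    exact (hm.comp (measurable_const.prodMk measurable_id)).aemeasurable
  simp_rw [h1]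
  rw [lintegral_lintegral_swap]
  · refine lintegral_congr fun n => ?_
    exact lintegral_update_mark hβ n (measurable_graph_comp α η r (lastTerm (n := n) k g))
  · refine Measurable.aemeasurable ?_
    have h2 : Measurable fun q : (Mark d × ℕ) × (ℕ → Mark d) × (Sym2 ℕ → I) =>
        lastTerm k g (augmentedGraph α η r q.1.1 (q.1.2, q.2)) :=
      hm.comp (measurable_fst.fst.prodMk (measurable_fst.snd.prodMk measurable_snd))
    exact h2.lintegral_prod_right'

/-- The Mecke formula for the number of vertices of degree `k`. -/
theorem lintegral_mul_degreeCountLaw {d : ℕ} {β : ℝ} (hβ : 0 < β) (α η s r : ℝ) (k : ℕ)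
    (g : ℕ → ℝ≥0∞) :
    ∫⁻ n, n * g n ∂degreeCountLaw d α β η s r k =
      ENNReal.ofReal s * ∫⁻ a, palmIntegral α β η s r k g a ∂markLaw d β := by
  have := isProbabilityMeasure_sequenceLaw d hβ
  rw [lintegral_palmIntegral hβ, degreeCountLaw, lintegral_map .of_discrete
    (measurable_poissonGraph_comp α η r fun _ => numDegree k), outcomeLaw_eq_prod,
    lintegral_prod _ (measurable_poissonGraph_comp α η r fun _ G =>
      (numDegree k G : ℝ≥0∞) * g (numDegree k G)).aemeasurable]
  refine Eq.trans ?_ (lintegral_mul_pred_poissonMeasure s.toNNReal _)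
  exact lintegral_congr fun n => lintegral_numDegree_mul hβ α η r k g n

end Mecke

/-! ### Palm integrals through the coupling -/

section Coupling

theorem measurableSet_hasDegreeEvent {d : ℕ} (α η r : ℝ) (k : ℕ) (x : EuclideanSpace ℝ (Fin d))
    (w : ℝ) : MeasurableSet (hasDegreeEvent α η r k x w) :=
  ((measurable_augmentedGraph_comp α η r fun _ => lastDegree).comp
    (measurable_const.prodMk measurable_id)) (measurableSet_singleton k)

theorem palmIntegral_eq_setLIntegral {d : ℕ} (α β η s r : ℝ) (k : ℕ) (g : ℕ → ℝ≥0∞)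
    (x : EuclideanSpace ℝ (Fin d)) (w : ℝ) :
    palmIntegral α β η s r k g (x, w) =
      ∫⁻ c in hasDegreeEvent α η r k x w, g (numDegree k (augmentedGraph α η r (x, w) c))
        ∂outcomeLaw d β s := by
  classical
  rw [← lintegral_indicator (measurableSet_hasDegreeEvent α η r k x w)]
  refine lintegral_congr fun c => ?_
  rw [Set.indicator_apply]
  exact if_congr Iff.rfl rfl rfl

theorem palmIntegral_one {d : ℕ} (α β η s r : ℝ) (k : ℕ) (x : EuclideanSpace ℝ (Fin d)) (w : ℝ) :
    palmIntegral α β η s r k (fun _ => 1) (x, w) = degreeProb α β η s r k x w := by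
  rw [palmIntegral_eq_setLIntegral, setLIntegral_one]
  rfl

theorem measurable_degreeProb {d : ℕ} {β : ℝ} (hβ : 0 < β) (α η s r : ℝ) (k : ℕ)
    (x : EuclideanSpace ℝ (Fin d)) : Measurable (degreeProb α β η s r k x) := by
  have h : degreeProb α β η s r k x = fun w => palmIntegral α β η s r k (fun _ => 1) (x, w) :=
    funext fun w => (palmIntegral_one α β η s r k x w).symm
  rw [h]
  exact (measurable_palmIntegral hβ α η s r k _).comp (measurable_const.prodMk measurable_id)

theorem degreeProb_mul_lintegral_conditionedCountLaw {d : ℕ} {β : ℝ} (hβ : 0 < β)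
    (α η s r : ℝ) (k : ℕ) (g : ℕ → ℝ≥0∞) (x : EuclideanSpace ℝ (Fin d)) (w : ℝ) :
    degreeProb α β η s r k x w * ∫⁻ n, g n ∂conditionedCountLaw α β η s r k x w =
      palmIntegral α β η s r k g (x, w) := by
  have := isProbabilityMeasure_outcomeLaw d hβ s
  have hN : Measurable fun c => numDegree k (augmentedGraph α η r (x, w) c) :=
    (measurable_augmentedGraph_comp α η r fun _ => numDegree k).comp
      (measurable_const.prodMk measurable_id)
  rw [palmIntegral_eq_setLIntegral, conditionedCountLaw, lintegral_map .of_discrete hN, ProbabilityTheory.cond,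
    lintegral_smul_measure, smul_eq_mul,
    ← mul_assoc, degreeProb]
  -- On a null event the conditioned law is the zero measure, and both sides vanish.
  by_cases h : outcomeLaw d β s (hasDegreeEvent α η r k x w) = 0
  · rw [Measure.restrict_eq_zero.2 h]
    simp
  · rw [ENNReal.mul_inv_cancel h (measure_ne_top _ _), one_mul]

/-- The densities X and E[X | m] define the same measure on m, hence the same integral of the
m-measurable Z. -/
theorem lintegral_condLExp_mul {Ω : Type*} {m m₀ : MeasurableSpace Ω} (hm : m ≤ m₀)
    (P : Measure[m₀] Ω) [IsFiniteMeasure P] {X Z : Ω → ℝ≥0∞} (hX : Measurable[m₀] X)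
    (hZ : Measurable[m] Z) :
    ∫⁻ ω, condLExp m P X ω * Z ω ∂P = ∫⁻ ω, X ω * Z ω ∂P := by
  have h : (P.withDensity (condLExp m P X)).trim hm = (P.withDensity X).trim hm := by
    refine @Measure.ext _ m _ _ fun t ht => ?_
    rw [trim_measurableSet_eq hm ht, trim_measurableSet_eq hm ht,
      withDensity_apply _ (hm t ht), withDensity_apply _ (hm t ht),
      setLIntegral_condLExp hm P X ht]
  have key : ∀ Y : Ω → ℝ≥0∞, Measurable[m₀] Y →
      ∫⁻ ω, Y ω * Z ω ∂P = ∫⁻ ω, Z ω ∂((P.withDensity Y).trim hm) := by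
    intro Y hY
    rw [lintegral_trim hm hZ, lintegral_withDensity_eq_lintegral_mul _ hY (hZ.mono hm le_rfl)]
    rfl
  rw [key _ (measurable_condLExp' _ _ _), key _ hX, h]

theorem lintegral_mul_le_of_lipschitz {Ω : Type*} [MeasurableSpace Ω] {P : Measure Ω}
    [IsFiniteMeasure P] {D V : Ω → ℕ} {W : Ω → ℝ} (hD : Measurable D) (hV : Measurable V)
    (hW : Measurable W) {p : ℝ → ℝ≥0∞} (hp : Measurable p) {g : ℕ → ℝ≥0∞} {κ : ℝ≥0∞}
    (hg : ∀ m n : ℕ, g m ≤ g n + κ * ENNReal.ofReal |(m : ℝ) - n|) :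
    ∫⁻ ω, p (W ω) * g (D ω) ∂P ≤ ∫⁻ ω, p (W ω) * g (V ω) ∂P +
      κ * ∫⁻ ω, condLExp (MeasurableSpace.comap W inferInstance) P
        (fun ω' => ENNReal.ofReal |(D ω' : ℝ) - (V ω' : ℝ)|) ω * p (W ω) ∂P := by
  have hpW : Measurable fun ω => p (W ω) := hp.comp hW
  have hX : Measurable fun ω => ENNReal.ofReal |(D ω : ℝ) - (V ω : ℝ)| := by
    have h1 : Measurable fun ω => (D ω : ℝ) := measurable_from_top.comp hD
    have h2 : Measurable fun ω => (V ω : ℝ) := measurable_from_top.comp hV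
    exact (h1.sub h2).abs.ennreal_ofReal
  have hgV : Measurable fun ω => g (V ω) := (Measurable.of_discrete (f := g)).comp hV
  have hcond : ∫⁻ ω, condLExp (MeasurableSpace.comap W inferInstance) P
      (fun ω' => ENNReal.ofReal |(D ω' : ℝ) - (V ω' : ℝ)|) ω * p (W ω) ∂P =
        ∫⁻ ω, ENNReal.ofReal |(D ω : ℝ) - (V ω : ℝ)| * p (W ω) ∂P :=
    lintegral_condLExp_mul hW.comap_le P hX (hp.comp (comap_measurable W))
  have hXp : Measurable fun ω => ENNReal.ofReal |(D ω : ℝ) - (V ω : ℝ)| * p (W ω) := hX.mul hpW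
  have hpg : Measurable fun ω => p (W ω) * g (V ω) := hpW.mul hgV
  rw [hcond, ← lintegral_const_mul _ hXp, ← lintegral_add_left hpg]
  refine lintegral_mono fun ω => ?_
  refine (mul_le_mul_right (hg (D ω) (V ω)) (p (W ω))).trans_eq ?_
  rw [mul_add, mul_comm (p (W ω)) (κ * _), mul_assoc]

variable {d : ℕ} {α β η s r : ℝ} {k : ℕ} {x : EuclideanSpace ℝ (Fin d)} {Ω : Type*}
  [MeasurableSpace Ω] {P : Measure Ω} [IsProbabilityMeasure P] {D : Ω → ℕ} {W : Ω → ℝ} {V : Ω → ℕ}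

theorem IsCouplingAt.lintegral_degreeProb_mul_coupled (h : IsCouplingAt α β η s r k x P D W V)
    (hβ : 0 < β) (g : ℕ → ℝ≥0∞) :
    ∫⁻ ω, degreeProb α β η s r k x (W ω) * g (V ω) ∂P =
      ∫⁻ w, palmIntegral α β η s r k (fun n => g (n - 1)) (x, w) ∂paretoMeasure 1 β := by
  have hp := measurable_degreeProb hβ α η s r k x
  have hV : Measurable fun ω => 1 + V ω := measurable_const.add h.measurable_coupled
  have hF : Measurable fun q : ℝ × ℕ => degreeProb α β η s r k x q.1 * g (q.2 - 1) :=
    (hp.comp measurable_fst).mul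
      ((Measurable.of_discrete (f := fun n : ℕ => g (n - 1))).comp measurable_snd)
  have h1 : ∫⁻ ω, degreeProb α β η s r k x (W ω) * g (V ω) ∂P =
      ∫⁻ q, degreeProb α β η s r k x q.1 * g (q.2 - 1) ∂(P.map fun ω => (W ω, 1 + V ω)) := by
    rw [lintegral_map hF (h.measurable_weight.prodMk hV)]
    simp
  have := isProbabilityMeasure_paretoMeasure one_pos hβ
  -- The joint law of W and 1 + V is disintegrated over W; multiplying by p̃ then removes the
  -- normalisation of the conditioned law.
  rw [h1, ← compProd_map_condDistrib hV.aemeasurable, h.law_weight,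
    Measure.lintegral_compProd hF]
  refine lintegral_congr_ae ?_
  filter_upwards [h.cond_law] with w hw
  rw [lintegral_const_mul _ .of_discrete, hw,
    degreeProb_mul_lintegral_conditionedCountLaw hβ α η s r k fun n => g (n - 1)]

theorem IsCouplingAt.lintegral_degreeProb_mul_count (h : IsCouplingAt α β η s r k x P D W V)
    (hβ : 0 < β) (g : ℕ → ℝ≥0∞) :
    ∫⁻ ω, degreeProb α β η s r k x (W ω) * g (D ω) ∂P =
      (∫⁻ w, palmIntegral α β η s r k (fun _ => 1) (x, w) ∂paretoMeasure 1 β) *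
        ∫⁻ n, g n ∂degreeCountLaw d α β η s r k := by
  have hp := measurable_degreeProb hβ α η s r k x
  simp_rw [palmIntegral_one]
  rw [← h.law_weight, ← h.law_count, lintegral_map hp h.measurable_weight,
    lintegral_map .of_discrete h.measurable_count]
  have hg : Measurable g := .of_discrete
  exact lintegral_mul_eq_lintegral_mul_lintegral_of_indepFun
    (hp.comp h.measurable_weight) (hg.comp h.measurable_count) (h.indep.symm.comp hp hg)

theorem IsCouplingAt.lintegral_le (h : IsCouplingAt α β η s r k x P D W V)
    (hβ : 0 < β) {g : ℕ → ℝ≥0∞} {κ : ℝ≥0∞}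
    (hg : ∀ m n : ℕ, g m ≤ g n + κ * ENNReal.ofReal |(m : ℝ) - n|) :
    (∫⁻ w, palmIntegral α β η s r k (fun _ => 1) (x, w) ∂paretoMeasure 1 β) *
        ∫⁻ n, g n ∂degreeCountLaw d α β η s r k ≤
      (∫⁻ w, palmIntegral α β η s r k (fun n => g (n - 1)) (x, w) ∂paretoMeasure 1 β) +
        κ * ∫⁻ ω, condLExp (MeasurableSpace.comap W inferInstance) P
          (fun ω' => ENNReal.ofReal |(D ω' : ℝ) - (V ω' : ℝ)|) ω *
            degreeProb α β η s r k x (W ω) ∂P := by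
  rw [← h.lintegral_degreeProb_mul_count hβ, ← h.lintegral_degreeProb_mul_coupled hβ]
  exact lintegral_mul_le_of_lipschitz h.measurable_count h.measurable_coupled
    h.measurable_weight (measurable_degreeProb hβ α η s r k x) hg

end Coupling

/-! ### Total variation and degenerate laws -/

section TotalVariation

/-- A one-sided bound for all A is two-sided, by taking complements. -/
theorem tvDist_le_of_forall_le {μ ν : Measure ℕ} [IsProbabilityMeasure μ]
    [IsProbabilityMeasure ν] {b : ℝ≥0∞} (h : ∀ A : Set ℕ, μ A ≤ ν A + b) : tvDist μ ν ≤ b := by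
  refine iSup_le fun A => ?_
  rcases eq_or_ne b ⊤ with rfl | hb
  · exact le_top
  have h' : ∀ A : Set ℕ, μ.real A - ν.real A ≤ b.toReal := by
    intro A
    have := ENNReal.toReal_mono (ENNReal.add_ne_top.2 ⟨measure_ne_top ν A, hb⟩) (h A)
    rw [ENNReal.toReal_add (measure_ne_top ν A) hb] at this
    simp only [measureReal_def]
    linarith
  refine ENNReal.ofReal_le_of_le_toReal (abs_le.2 ⟨?_, h' A⟩)
  have := h' Aᶜ
  rw [probReal_compl_eq_one_sub .of_discrete, probReal_compl_eq_one_sub .of_discrete] at this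
  linarith

theorem eq_dirac_zero_of_lintegral_eq_zero {μ : Measure ℕ} [IsProbabilityMeasure μ]
    (h : ∫⁻ n, (n : ℝ≥0∞) ∂μ = 0) : μ = Measure.dirac 0 := by
  have h0 : (id : ℕ → ℕ) =ᵐ[μ] fun _ => 0 := by
    filter_upwards [(lintegral_eq_zero_iff .of_discrete).1 h] with n hn
    simpa using hn
  calc μ = μ.map id := Measure.map_id.symm
    _ = μ.map fun _ => 0 := Measure.map_congr h0
    _ = _ := by simp

end TotalVariation

end WeightedRCM

open WeightedRCM in
theorem theorem4p1 (d : ℕ) (hd : 2 ≤ d) (α β η s r : ℝ) (hα : 0 < α) (hβ : 0 < β) (hη : 0 < η)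
    (hs : 0 < s) (hr : 0 < r) (k : ℕ)
    (Ω : EuclideanSpace ℝ (Fin d) → Type*) [∀ x, MeasurableSpace (Ω x)]
    (P : ∀ x, Measure (Ω x)) [∀ x, IsProbabilityMeasure (P x)]
    (D : ∀ x, Ω x → ℕ) (W : ∀ x, Ω x → ℝ) (V : ∀ x, Ω x → ℕ)
    (hV : ∀ᵐ x ∂(volume.restrict (cube d)),
      IsCouplingAt α β η s r k x (P x) (D x) (W x) (V x)) :
    tvDist (degreeCountLaw d α β η s r k)
        (poissonMeasure (meanDegreeCount d α β η s r k).toNNReal) ≤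
      min 1 (meanDegreeCount d α β η s r k)⁻¹ * ENNReal.ofReal s *
        ∫⁻ x in cube d, ∫⁻ ω,
          condLExp (MeasurableSpace.comap (W x) inferInstance) (P x)
              (fun ω' => ENNReal.ofReal |(D x ω' : ℝ) - (V x ω' : ℝ)|) ω *
            degreeProb α β η s r k x (W x ω) ∂(P x) := by
  have := isProbabilityMeasure_markLaw d hβ
  have := isProbabilityMeasure_outcomeLaw d hβ s
  have := isProbabilityMeasure_restrict_cube d
  have := isProbabilityMeasure_paretoMeasure one_pos hβ
  have := isProbabilityMeasure_degreeCountLaw d hβ α η s r k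
  set L := degreeCountLaw d α β η s r k with hL
  have mecke : ∀ g : ℕ → ℝ≥0∞, ∫⁻ n, n * g n ∂L = ENNReal.ofReal s *
      ∫⁻ x in cube d, ∫⁻ w, palmIntegral α β η s r k g (x, w) ∂paretoMeasure 1 β := by
    intro g
    rw [lintegral_mul_degreeCountLaw hβ, markLaw,
      lintegral_prod _ (measurable_palmIntegral hβ α η s r k g).aemeasurable]
  have hmean : meanDegreeCount d α β η s r k = ∫⁻ n, (n : ℝ≥0∞) ∂L := by
    rw [hL, degreeCountLaw, lintegral_map .of_discrete
      (measurable_poissonGraph_comp α η r fun _ => numDegree k)]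
    rfl
  have hmean' : ∫⁻ n, (n : ℝ≥0∞) ∂L = ENNReal.ofReal s * ∫⁻ x in cube d,
      ∫⁻ w, palmIntegral α β η s r k (fun _ => 1) (x, w) ∂paretoMeasure 1 β := by
    simpa using mecke fun _ => 1
  have hfin : ∫⁻ n, (n : ℝ≥0∞) ∂L ≠ ⊤ := by
    rw [hmean']
    refine ENNReal.mul_ne_top ENNReal.ofReal_ne_top (ne_top_of_le_ne_top ENNReal.one_ne_top ?_)
    calc _ ≤ ∫⁻ x in cube d, ∫⁻ _, 1 ∂paretoMeasure 1 β := by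
          refine lintegral_mono fun x => lintegral_mono fun w => ?_
          rw [palmIntegral_one]
          exact prob_le_one
      _ = 1 := by simp only [lintegral_one, measure_univ]
  rw [hmean]
  lift ∫⁻ n, (n : ℝ≥0∞) ∂L to NNReal using hfin with l hl
  rw [ENNReal.toNNReal_coe]
  -- Stein's equation needs l > 0; for l = 0 both laws are the point mass at 0.
  rcases eq_zero_or_pos l with rfl | hlpos
  · have h1 := eq_dirac_zero_of_lintegral_eq_zero hl.symm
    have h2 : poissonMeasure 0 = Measure.dirac 0 := eq_dirac_zero_of_lintegral_eq_zero <| by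
      simpa using lintegral_mul_pred_poissonMeasure 0 fun _ => 1
    rw [h1, h2]
    simp [tvDist]
  refine tvDist_le_of_forall_le fun A => ?_
  obtain ⟨g, c, hstein, hlip⟩ := exists_stein_nnreal hlpos A
  set κ : ℝ≥0∞ := min 1 (l : ℝ≥0∞)⁻¹
  have hκ1 : κ ≤ 1 := min_le_left _ _
  -- Since κ ≤ 1, g grows at most linearly, and D has finite mean.
  have hgfin : ∫⁻ n, (g n : ℝ≥0∞) ∂L ≠ ⊤ := by
    refine ne_top_of_le_ne_top (b := (g 0 : ℝ≥0∞) + l) (by finiteness) ?_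
    calc ∫⁻ n, (g n : ℝ≥0∞) ∂L ≤ ∫⁻ n, ((g 0 : ℝ≥0∞) + n) ∂L := by
          refine lintegral_mono fun n => (hlip n 0).trans ?_
          gcongr
          refine (mul_le_of_le_one_left' hκ1).trans ?_
          simp
      _ = _ := by rw [lintegral_add_left measurable_const, ← hl]; simp
  have hcompare : l * ∫⁻ n, (g n : ℝ≥0∞) ∂L ≤ ∫⁻ n, (n : ℝ≥0∞) * g (n - 1) ∂L +
      κ * ENNReal.ofReal s * ∫⁻ x in cube d, ∫⁻ ω,
          condLExp (MeasurableSpace.comap (W x) inferInstance) (P x)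
              (fun ω' => ENNReal.ofReal |(D x ω' : ℝ) - (V x ω' : ℝ)|) ω *
            degreeProb α β η s r k x (W x ω) ∂(P x) := by
    have hm : ∀ g, Measurable fun x : EuclideanSpace ℝ (Fin d) =>
        ∫⁻ w, palmIntegral α β η s r k g (x, w) ∂paretoMeasure 1 β := fun g =>
      (measurable_palmIntegral hβ α η s r k g).lintegral_prod_right'
    -- The coupling integrand may fail to be measurable in x: additivity uses measurability of the
    -- Palm term only, and κ is moved inside because it is finite.
    rw [mecke fun n => (g (n - 1) : ℝ≥0∞), hmean', mul_assoc, mul_comm κ, mul_assoc,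
      ← mul_add, ← lintegral_mul_const _ (hm _),
      ← lintegral_const_mul' _ _ (ne_top_of_le_ne_top ENNReal.one_ne_top hκ1),
      ← lintegral_add_left (hm _)]
    refine mul_le_mul' le_rfl ?_
    refine lintegral_mono_ae ?_
    filter_upwards [hV] with x hx
    exact hx.lintegral_le hβ hlip
  have hident : L A + ∫⁻ n, (n : ℝ≥0∞) * g (n - 1) ∂L + c * l =
      poissonMeasure l A + l * ∫⁻ n, (g n : ℝ≥0∞) ∂L + c * l := by
    -- As L has mean l, the term c n integrates to c l, so the translation cancels.
    have h := lintegral_congr (μ := L) hstein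
    rw [lintegral_add_left .of_discrete, lintegral_add_left .of_discrete,
      lintegral_add_left .of_discrete, lintegral_add_left .of_discrete,
      lintegral_indicator_one .of_discrete, lintegral_const, lintegral_const, lintegral_const_mul _ .of_discrete,
      lintegral_const_mul _ .of_discrete, ← hl] at h
    simpa using h
  have hident' := (ENNReal.add_left_inj (by finiteness)).1 hident
  have hfin' : ∫⁻ n, (n : ℝ≥0∞) * g (n - 1) ∂L ≠ ⊤ := by
    refine ne_top_of_le_ne_top ?_ (le_add_self.trans hident'.le)
    finiteness
  refine (ENNReal.add_le_add_iff_right hfin').1 ?_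
  rw [hident']
  exact (add_le_add le_rfl hcompare).trans_eq (by ring)
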